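/- Let $d,k\ge 1$ and let $\Phi:M_d(\mathbb C)\to M_d(\mathbb C)$ be a quantum channel, i.e. a completely positive linear map with $\Phi(\mathrm{Id})=\mathrm{Id}$, with a Kraus decomposition $\Phi(X)=\sum_{i=1}^k v_i^*Xv_i$, $v_1,\dots,v_k\in M_d(\mathbb C)$. For $u\in U(k)$ (the group of unitary $k\times k$ matrices, with its Borel $\sigma$-algebra) put $v(u)=\sum_{j=1}^k u_{1j}v_j$. Let $\lambda$ be a Borel probability measure on $U(k)$, for each $i\in\{1,\dots,k\}$ let $u(i)\in U(k)$ be a matrix with first row $u(i)_{1l}=\delta_{l,i}$, let $\lambda_i$ be the image of $\lambda$ under $u\mapsto u(i)u$, and let $\mu=\sum_{i=1}^k\lambda_i$. Assume that $\Phi$ is irreducible: there is an integer $n\ge 1$ such that $(\mathrm{Id}+\Phi)^n(X)$ is positive definite for every non-zero positive semi-definite $X\in M_d(\mathbb C)$. Assume also that $\mu$ is non-singular: the topological support of $\mu$ has positive Haar measure in $U(k)$. Then $\mu$ purifies. That is, $u\mapsto v(u)$ is measurable, $\int_{U(k)}v(u)^*v(u)\,d\mu(u)=\mathrm{Id}$,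 and every orthogonal projector $\pi\in M_d(\mathbb C)$ with the following property has rank at most $1$: for every integer $p\ge 1$ and $\mu^{\otimes p}$-almost all $(u_1,\dots,u_p)\in U(k)^p$, $$\pi\, v(u_1)^*\cdots v(u_p)^*v(u_p)\cdots v(u_1)\,\pi=\|v(u_p)\cdots v(u_1)\pi\|^2\,\pi,$$ where $\|\cdot\|$ is the operator norm. -/

import Mathlib

noncomputable section

open MeasureTheory Matrix
open scoped ComplexOrder

namespace RandomizedTrajectory

/-- The unitary group `U(k)`. -/
abbrev U (k : ℕ) : Type := Matrix.unitaryGroup (Fin k) ℂ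

/-- `U(k)` carries its Borel σ-algebra. -/
instance instMeasurableSpaceU (k : ℕ) : MeasurableSpace (U k) := borel _

instance instBorelSpaceU (k : ℕ) : BorelSpace (U k) := ⟨rfl⟩

instance instCompactSpaceU (k : ℕ) : CompactSpace (U k) := by
  have hbox : IsCompact (Set.pi Set.univ (fun _ : Fin k =>
      Set.pi Set.univ (fun _ : Fin k => Metric.closedBall (0 : ℂ) 1))) :=
    isCompact_univ_pi fun _ => isCompact_univ_pi fun _ => isCompact_closedBall _ _
  have hclosed : IsClosed {A : Matrix (Fin k) (Fin k) ℂ | A * star A = 1} :=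
    isClosed_eq (continuous_id.mul continuous_star) continuous_const
  have heq : ((Matrix.unitaryGroup (Fin k) ℂ : Submonoid (Matrix (Fin k) (Fin k) ℂ)) :
      Set (Matrix (Fin k) (Fin k) ℂ)) = {A | A * star A = 1} := by
    ext A
    exact Matrix.mem_unitaryGroup_iff
  refine isCompact_iff_compactSpace.mp ?_
  rw [heq]
  refine IsCompact.of_isClosed_subset hbox hclosed ?_
  intro A hA i _ j _
  simpa using entry_norm_bound_of_unitary (Matrix.mem_unitaryGroup_iff.mpr hA) i j

/-- The Haar probability measure on the compact group `U(k)`. -/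
def haarU (k : ℕ) : Measure (U k) := Measure.haarMeasure ⊤

/-- A measure on `U(k)` is non-singular if its topological support has positive Haar measure. -/
def NonSingular {k : ℕ} (μ : Measure (U k)) : Prop := 0 < haarU k μ.support

/-- Complete positivity: for every `n`, applying `Φ` to all blocks of a positive semi-definite
`n × n` block matrix with blocks in `M_d(ℂ)` gives a positive semi-definite block matrix. -/
def CompletelyPositive {d : ℕ}
    (Φ : Matrix (Fin d) (Fin d) ℂ →ₗ[ℂ] Matrix (Fin d) (Fin d) ℂ) : Prop :=
  ∀ (n : ℕ) (M : Matrix (Fin n) (Fin n) (Matrix (Fin d) (Fin d) ℂ)),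
    (Matrix.comp (Fin n) (Fin n) (Fin d) (Fin d) ℂ M).PosSemidef →
      (Matrix.comp (Fin n) (Fin n) (Fin d) (Fin d) ℂ (M.map Φ)).PosSemidef

/-- A quantum channel on observables: a completely positive unit-preserving linear map. -/
structure IsQuantumChannel {d : ℕ}
    (Φ : Matrix (Fin d) (Fin d) ℂ →ₗ[ℂ] Matrix (Fin d) (Fin d) ℂ) : Prop where
  completelyPositive : CompletelyPositive Φ
  map_one : Φ 1 = 1

/-- `(v_i)` is a Kraus decomposition of `Φ`: `Φ(X) = ∑ i, v_i^* X v_i`. -/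
def IsKrausDecomposition {d k : ℕ}
    (Φ : Matrix (Fin d) (Fin d) ℂ →ₗ[ℂ] Matrix (Fin d) (Fin d) ℂ)
    (v : Fin k → Matrix (Fin d) (Fin d) ℂ) : Prop :=
  ∀ X, Φ X = ∑ i, (v i)ᴴ * X * v i

/-- `Φ` is irreducible: for some `n ≥ 1`, `(Id + Φ)^n` maps every non-zero positive semi-definite
matrix to a positive definite one. -/
def IsIrreducible {d : ℕ}
    (Φ : Matrix (Fin d) (Fin d) ℂ →ₗ[ℂ] Matrix (Fin d) (Fin d) ℂ) : Prop :=
  ∃ n : ℕ, 1 ≤ n ∧ ∀ X : Matrix (Fin d) (Fin d) ℂ, X.PosSemidef → X ≠ 0 →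
    (((1 + Φ : Module.End ℂ (Matrix (Fin d) (Fin d) ℂ)) ^ n) X).PosDef

/-- The randomized Kraus operator `v(u) = ∑ j, u_{1j} v_j` (the first row has index `0`). -/
def krausAt {d k : ℕ} [NeZero k] (v : Fin k → Matrix (Fin d) (Fin d) ℂ) (u : U k) :
    Matrix (Fin d) (Fin d) ℂ :=
  ∑ j, (u : Matrix (Fin k) (Fin k) ℂ) 0 j • v j

/-- `r = (u(1), …, u(k))` is such that the first row of the unitary matrix `u(i)` is the `i`-th
vector of the canonical basis. -/
def IsRowSelector {k : ℕ} [NeZero k] (r : Fin k → U k) : Prop :=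
  ∀ i l, (r i : Matrix (Fin k) (Fin k) ℂ) 0 l = if l = i then 1 else 0

/-- `μ = ∑ i, λ_i`, where `λ_i` is the image of `λ` by the map `u ↦ u(i) u`. -/
def outcomeMeasure {k : ℕ} (r : Fin k → U k) (lam : Measure (U k)) : Measure (U k) :=
  ∑ i, lam.map (fun u => r i * u)

instance instIsFiniteMeasureOutcomeMeasure {k : ℕ} (r : Fin k → U k) (lam : Measure (U k))
    [IsFiniteMeasure lam] : IsFiniteMeasure (outcomeMeasure r lam) := by
  unfold outcomeMeasure
  infer_instance

/-- The operator norm of a matrix acting on `ℂ^d` with its Hermitian norm. -/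
def opNorm {d : ℕ} (A : Matrix (Fin d) (Fin d) ℂ) : ℝ :=
  ‖Matrix.toEuclideanCLM (n := Fin d) (𝕜 := ℂ) A‖

/-- The product `v(ω_p) ⋯ v(ω_1)`. -/
def trajectoryProd {Ω : Type*} {d p : ℕ} (v : Ω → Matrix (Fin d) (Fin d) ℂ) (ω : Fin p → Ω) :
    Matrix (Fin d) (Fin d) ℂ :=
  (List.ofFn fun i => v (ω i)).reverse.prod

/-- The measure `κ` purifies (with respect to the map `v`). The first three fields are the setting
of the notion: `v` is measurable and `∫ v^* v dκ = Id` (entrywise). The last one is the property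
itself: every orthogonal projector `π` such that, for all `p ≥ 1` and `κ^{⊗p}`-almost all
`(ω_1, …, ω_p)`, with `W = v(ω_p) ⋯ v(ω_1)`, one has `π W^* W π = ‖W π‖² π`,
has rank at most one. -/
structure Purifies {Ω : Type*} [MeasurableSpace Ω] {d : ℕ} (κ : Measure Ω) [SigmaFinite κ]
    (v : Ω → Matrix (Fin d) (Fin d) ℂ) : Prop where
  measurable : ∀ i j, Measurable fun ω => v ω i j
  integrable : ∀ i j, Integrable (fun ω => ((v ω)ᴴ * v ω) i j) κ
  integral_eq_one : ∀ i j,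
    ∫ ω, ((v ω)ᴴ * v ω) i j ∂κ = (1 : Matrix (Fin d) (Fin d) ℂ) i j
  rank_le_one : ∀ π : Matrix (Fin d) (Fin d) ℂ, IsStarProjection π →
    (∀ p : ℕ, 1 ≤ p → ∀ᵐ ω ∂(Measure.pi fun _ : Fin p => κ),
      π * (trajectoryProd v ω)ᴴ * trajectoryProd v ω * π =
        ((opNorm (trajectoryProd v ω * π) ^ 2 : ℝ) : ℂ) • π) →
    π.rank ≤ 1

end RandomizedTrajectory

end

open MeasureTheory Matrix Filter Topology
open scoped ComplexOrder

/-! Suppose a projector `P` satisfies the purification identity and has rank at least two. The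
identity says that every trajectory product `W` sends orthogonal vectors `x`, `y` in the range of
`P` to orthogonal vectors, almost surely and hence, by continuity, for all outcomes in the support
`S` of the measure (`trajectoryOrthogonal_of_ae`). For fixed later outcomes, with product `W`, the
inner product of `W v(u) x` and `W v(u) y` is a sesquilinear form evaluated at the first row of `u`.
It vanishes on `S`, which has positive Haar measure, so it is zero (`rowForm_eq_zero`). Hence `v_a
x` and `v_b y` inherit the property for all `a`, `b`, including `a ≠ b`.

By iteration, the words of length `q` in the `v_i` send `x` and `y` into orthogonal subspaces. If
`Q` projects onto the first one, then `Φ^q(Q)` fixes `x` and kills `y`. Since `Φ` is a contraction,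
compactness yields such an observable in the span of the eigenvectors of `Φ` with unimodular
eigenvalue (`exists_mem_peripheralSubspace_apply_eq`).

For irreducible `Φ` this span is commutative (`IsPhaseCommuting.commute`): equality in
Kadison–Schwarz makes each such eigenvector commute with the `v_i` up to a phase, and the phases
form a finite cyclic group. But the observables `X`, `Y` obtained from the pairs `(x, y)` and `(x +
y, x - y)` satisfy `XYy = x/2` and `YXy = 0`, a contradiction. -/

namespace RandomizedTrajectory

/-! ### Finite-dimensional function spaces on a compact group. -/

section CompactGroup

variable {G : Type*} [Group G] [TopologicalSpace G] [IsTopologicalGroup G] [CompactSpace G]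
  [T2Space G] [MeasurableSpace G] [BorelSpace G]

/-- A right translate of a left Haar probability measure is again one, so uniqueness applies. -/
theorem isMulRightInvariant_of_compactSpace (μ : Measure G) [μ.IsHaarMeasure] [μ.Regular]
    [IsProbabilityMeasure μ] : μ.IsMulRightInvariant where
  map_mul_right_eq_self g := by
    have : IsProbabilityMeasure (μ.map (· * g)) :=
      Measure.isProbabilityMeasure_map (measurable_mul_const g).aemeasurable
    have : (μ.map (· * g)).Regular := Measure.Regular.map (Homeomorph.mulRight g)
    exact Measure.isHaarMeasure_eq_of_isProbabilityMeasure _ _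

/-- A Steinhaus argument: enclose `K` in an open `U` of measure less than `2 μ K`. For `h` near `1`
one has `K h ⊆ U`, so `K` and its translate both lie in a translate of `U`, which is too small to
hold them almost disjointly. -/
theorem eventually_measure_inter_translate_pos (μ : Measure G) [μ.IsMulRightInvariant]
    [IsFiniteMeasure μ] [μ.Regular] {K : Set G} (hK : IsCompact K) (hpos : μ K ≠ 0) :
    ∀ᶠ h in 𝓝 (1 : G), μ (K ∩ (· * h) ⁻¹' K) ≠ 0 := by
  obtain ⟨U, hKU, hU, hμU⟩ := hK.exists_isOpen_lt_add (μ := μ) hpos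
  obtain ⟨V, hV, hKV⟩ := compact_open_separated_mul_right hK hU hKU
  filter_upwards [hV] with h hh h0
  have hpre : ∀ s : Set G, μ ((· * h) ⁻¹' s) = μ s := fun s => measure_preimage_mul_right μ h s
  have hmeas : MeasurableSet ((· * h) ⁻¹' K) := measurable_mul_const h hK.measurableSet
  have h1 : μ K + μ K ≤ μ U := by
    calc μ K + μ K = μ K + μ ((· * h) ⁻¹' K) := by rw [hpre]
      _ = μ (K ∪ (· * h) ⁻¹' K) + μ (K ∩ (· * h) ⁻¹' K) := (measure_union_add_inter K hmeas).symm
      _ = μ (K ∪ (· * h) ⁻¹' K) := by rw [h0, add_zero]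
      _ ≤ μ ((· * h) ⁻¹' U) := by
        refine measure_mono (Set.union_subset (fun x hx => ?_) (Set.preimage_mono hKU))
        exact hKV (Set.mul_mem_mul hx hh)
      _ = μ U := hpre U
  exact absurd hμU (not_lt.mpr h1)

/-- A function in a finite-dimensional translation-invariant space which vanishes on a set of
positive Haar measure vanishes on a translate of a submonoid generated by a neighborhood of `1`. -/
theorem exists_vanish_on_translate_closure {𝕜 : Type*} [Field 𝕜] (μ : Measure G)
    [μ.IsMulRightInvariant] [IsFiniteMeasure μ] [μ.Regular]
    (W : Submodule 𝕜 (G → 𝕜)) [FiniteDimensional 𝕜 W]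
    (hW : ∀ f ∈ W, ∀ h : G, (fun u => f (u * h)) ∈ W) {S : Set G} (hS : IsClosed S)
    (hpos : μ S ≠ 0) {f : G → 𝕜} (hf : f ∈ W) (hfS : ∀ u ∈ S, f u = 0) :
    ∃ u : G, ∃ V ∈ 𝓝 (1 : G), ∀ h ∈ Submonoid.closure V, f (u * h) = 0 := by
  let F : Set G → Submodule 𝕜 W := fun T =>
    { carrier := {g | ∀ u ∈ T, g.1 u = 0}
      add_mem' := fun {a b} ha hb u hu => by simp [ha u hu, hb u hu]
      zero_mem' := fun u _ => rfl
      smul_mem' := fun c a ha u hu => by simp [ha u hu] }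
  have hFanti : ∀ {T T' : Set G}, T ⊆ T' → F T' ≤ F T := fun h g hg u hu => hg u (h hu)
  -- Finite dimension provides a `K` whose space `F K` of functions vanishing on it is maximal.
  -- Replacing `K` by its intersection with a nearby translate cannot enlarge `F K`, which makes `F
  -- K` stable under small translations.
  obtain ⟨N, ⟨K, hKS, hKc, hKpos, rfl⟩, hmax⟩ := WellFounded.has_min
    (wellFounded_gt (α := Submodule 𝕜 W))
    {N | ∃ K ⊆ S, IsClosed K ∧ μ K ≠ 0 ∧ N = F K} ⟨F S, S, subset_rfl, hS, hpos, rfl⟩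
  have hev := eventually_measure_inter_translate_pos μ hKc.isCompact hKpos
  have hstep : ∀ h, μ (K ∩ (· * h) ⁻¹' K) ≠ 0 → ∀ g : W, g ∈ F K →
      (⟨fun u => g.1 (u * h), hW g.1 g.2 h⟩ : W) ∈ F K := by
    intro h hh g hg
    have hle : F K ≤ F (K ∩ (· * h) ⁻¹' K) := hFanti Set.inter_subset_left
    have heq : F K = F (K ∩ (· * h) ⁻¹' K) := by
      by_contra hne
      exact hmax _ ⟨_, Set.inter_subset_left.trans hKS,
        hKc.inter (hKc.preimage (continuous_mul_const h)), hh, rfl⟩ (lt_of_le_of_ne hle hne)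
    rw [heq]
    exact fun u hu => hg _ hu.2
  obtain ⟨u₀, hu₀⟩ : K.Nonempty := nonempty_of_measure_ne_zero hKpos
  refine ⟨u₀, _, hev, fun h hh => ?_⟩
  have key : ∀ h ∈ Submonoid.closure {h | μ (K ∩ (· * h) ⁻¹' K) ≠ 0}, ∀ g : W, g ∈ F K →
      (⟨fun u => g.1 (u * h), hW g.1 g.2 h⟩ : W) ∈ F K := by
    intro h hh
    induction hh using Submonoid.closure_induction with
    | mem x hx => exact hstep x hx
    | one => intro g hg; simpa using hg
    | mul x y _ _ hx hy =>
      intro g hg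
      have := hx _ (hy g hg)
      simpa [mul_assoc] using this
  exact key h hh ⟨f, hf⟩ (fun u hu => hfS u (hKS hu)) u₀ hu₀

end CompactGroup

/-! ### Quadratic forms in the first row of a unitary matrix. -/

theorem isProbabilityMeasure_haarU (k : ℕ) : IsProbabilityMeasure (haarU k) :=
  ⟨by simpa [haarU] using Measure.haarMeasure_self (G := U k) (K₀ := ⊤)⟩

/-- Every element of a circle subgroup has `n`-th roots in it tending to `1`, hence eventually in
`V`. -/
theorem circleHom_mem_closure {G : Type*} [Group G] [TopologicalSpace G] (φ : Circle →* G)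
    (hφ : Continuous φ) {V : Set G} (hV : V ∈ 𝓝 (1 : G)) (ζ : Circle) :
    φ ζ ∈ Submonoid.closure V := by
  obtain ⟨θ, rfl⟩ : ∃ θ : ℝ, Circle.exp θ = ζ := ⟨_, Circle.exp_arg ζ⟩
  have hlim : Tendsto (fun n : ℕ => φ (Circle.exp (θ / (n : ℝ)))) atTop (𝓝 1) := by
    have h0 : Tendsto (fun n : ℕ => θ / (n : ℝ)) atTop (𝓝 0) :=
      tendsto_const_div_atTop_nhds_zero_nat θ
    have hc : Continuous fun t : ℝ => φ (Circle.exp t) := hφ.comp Circle.exp.continuous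
    have h1 := (hc.tendsto 0).comp h0
    simp only [Circle.exp_zero, map_one] at h1
    exact h1
  obtain ⟨n, hnV, hn⟩ := ((hlim.eventually hV).and (eventually_gt_atTop 0)).exists
  have hpow : φ (Circle.exp θ) = φ (Circle.exp (θ / (n : ℝ))) ^ n := by
    rw [← map_pow, ← Circle.exp_nsmul]
    congr 2
    have : (n : ℝ) ≠ 0 := by positivity
    simp; field_simp
  rw [hpow]
  exact pow_mem (Submonoid.subset_closure hnV) n

/-- The unitaries acting as a scalar on the range of an orthogonal projector `P` and trivially on
its orthogonal complement. -/
def scalarOnRange {k : ℕ} (P : Matrix (Fin k) (Fin k) ℂ) (hP : Pᴴ = P) (hPP : P * P = P) :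
    Circle →* U k where
  toFun ζ := ⟨1 + ((ζ : ℂ) - 1) • P, by
    rw [Matrix.mem_unitaryGroup_iff, star_eq_conjTranspose]
    have h : (ζ : ℂ) * star (ζ : ℂ) = 1 := by
      simp [Complex.mul_conj]
    simp only [conjTranspose_add, conjTranspose_one, conjTranspose_smul, hP, mul_add, add_mul,
      one_mul, mul_one, smul_mul_smul_comm, hPP, star_sub, star_one]
    have : ((ζ : ℂ) - 1) * (star (ζ : ℂ) - 1) = -((ζ : ℂ) - 1) - (star (ζ : ℂ) - 1) := by
      linear_combination h
    rw [this]
    module⟩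
  map_one' := by ext; simp
  map_mul' a b := by
    apply Subtype.ext
    simp only [Submonoid.coe_mul, mul_add, add_mul, one_mul, mul_one, smul_mul_smul_comm, hPP,
      Circle.coe_mul]
    module

theorem continuous_scalarOnRange {k : ℕ} (P : Matrix (Fin k) (Fin k) ℂ) (hP : Pᴴ = P)
    (hPP : P * P = P) : Continuous (scalarOnRange P hP hPP) := by
  refine Continuous.subtype_mk ?_ _
  fun_prop

/-- A complex Householder reflection: `P` projects onto the line of `x - y`, and the phase `ζ` is
the one forced by `x ↦ y`. Circle subgroups thus act transitively on unit vectors, so connectedness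
of `U(k)` is not needed separately. -/
theorem exists_scalarOnRange_vecMul_eq {k : ℕ} {x y : Fin k → ℂ} (hx : star x ⬝ᵥ x = 1)
    (hy : star y ⬝ᵥ y = 1) :
    ∃ (P : Matrix (Fin k) (Fin k) ℂ) (hP : Pᴴ = P) (hPP : P * P = P) (ζ : Circle),
      x ᵥ* (scalarOnRange P hP hPP ζ : Matrix (Fin k) (Fin k) ℂ) = y := by
  by_cases hxy : x = y
  · exact ⟨0, by simp, by simp, 1, by simp [hxy]⟩
  set w := x - y with hw
  set N : ℂ := star w ⬝ᵥ w with hN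
  have hN0 : N ≠ 0 := by
    rw [hN, Ne, dotProduct_star_self_eq_zero, hw, sub_eq_zero]
    exact hxy
  have hNstar : star N = N := by
    rw [hN, ← star_dotProduct]
  set s : ℂ := star y ⬝ᵥ x with hs
  have hs' : star x ⬝ᵥ y = star s := by
    rw [hs, ← star_dotProduct]
  have hNs : N = 2 - s - star s := by
    rw [hN, hw, star_sub, sub_dotProduct, dotProduct_sub, dotProduct_sub, hx, hy, hs', ← hs]
    ring
  have hwx : star w ⬝ᵥ x = 1 - s := by
    rw [hw, star_sub, sub_dotProduct, hx]
  have hs1 : 1 - s ≠ 0 := by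
    intro h
    have : s = 1 := by linear_combination -h
    apply hN0
    rw [hNs, this]; simp; norm_num
  let P : Matrix (Fin k) (Fin k) ℂ := N⁻¹ • vecMulVec (star w) w
  have hP : Pᴴ = P := by
    simp only [P, conjTranspose_smul, star_inv₀, hNstar]
    congr 1
    rw [conjTranspose_vecMulVec, star_star]
  have hPP : P * P = P := by
    simp only [P, smul_mul_smul_comm, vecMulVec_mul_vecMulVec]
    rw [dotProduct_comm, ← hN]
    simp [smul_smul, hN0]
  have hζ : (-(1 - star s) / (1 - s)) ∈ Submonoid.unitSphere ℂ := by
    have h1 : ‖1 - star s‖ = ‖1 - s‖ := by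
      rw [← norm_star (1 - s), star_sub, star_one]
    refine mem_sphere_zero_iff_norm.mpr ?_
    rw [norm_div, norm_neg, h1, div_self (norm_ne_zero_iff.mpr hs1)]
  refine ⟨P, hP, hPP, ⟨_, hζ⟩, ?_⟩
  change x ᵥ* (1 + (-(1 - star s) / (1 - s) - 1) • P) = y
  have hxP : x ᵥ* P = (N⁻¹ * (1 - s)) • w := by
    simp only [P, vecMul_smul]
    rw [vecMul_vecMulVec, dotProduct_comm, hwx, smul_smul]
  rw [vecMul_add, vecMul_one, vecMul_smul, hxP, smul_smul]
  have : (-(1 - star s) / (1 - s) - 1) * (N⁻¹ * (1 - s)) = -1 := by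
    have : -(1 - star s) / (1 - s) - 1 = - N / (1 - s) := by
      rw [hNs]; field_simp; ring
    rw [this]; field_simp
  rw [this, hw]; module

theorem eq_zero_of_quadraticForm_unit {k : ℕ} {M : Matrix (Fin k) (Fin k) ℂ}
    (h : ∀ y : Fin k → ℂ, star y ⬝ᵥ y = 1 → star y ⬝ᵥ (M *ᵥ y) = 0) : M = 0 := by
  have hall : ∀ y : Fin k → ℂ, star y ⬝ᵥ (M *ᵥ y) = 0 := by
    intro y
    by_cases hy : y = 0
    · simp [hy]
    set N : ℝ := ‖WithLp.toLp 2 y‖ with hN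
    have hN0 : (N : ℂ) ≠ 0 := by simpa [hN] using hy
    have hNN : star y ⬝ᵥ y = (N : ℂ) ^ 2 := by
      have := inner_self_eq_norm_sq_to_K (𝕜 := ℂ) (WithLp.toLp 2 y)
      rw [EuclideanSpace.inner_toLp_toLp, dotProduct_comm] at this
      exact this
    have h1 := h ((N : ℂ)⁻¹ • y) (by
      simp only [star_smul, smul_dotProduct, dotProduct_smul, hNN, smul_eq_mul, star_inv₀]
      simp; field_simp)
    simp only [star_smul, smul_dotProduct, dotProduct_smul, mulVec_smul, smul_eq_mul, star_inv₀]
      at h1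
    simpa [hN0] using h1
  have : Matrix.toEuclideanLin M = 0 := by
    rw [← inner_map_self_eq_zero]
    intro x
    rw [EuclideanSpace.inner_eq_star_dotProduct, dotProduct_comm]
    have := congrArg star (hall x.ofLp)
    rw [star_dotProduct] at this
    simpa using this
  simpa using this

theorem rowForm_eq_zero {k : ℕ} [NeZero k] {S : Set (U k)} (hS : IsClosed S)
    (hpos : 0 < haarU k S) {M : Matrix (Fin k) (Fin k) ℂ}
    (h : ∀ u ∈ S, star ((u : Matrix (Fin k) (Fin k) ℂ) 0) ⬝ᵥ
      (M *ᵥ (u : Matrix (Fin k) (Fin k) ℂ) 0) = 0) : M = 0 := by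
  have := isProbabilityMeasure_haarU k
  have : (haarU k).IsHaarMeasure := by unfold haarU; infer_instance
  have : (haarU k).Regular := by unfold haarU; infer_instance
  have := isMulRightInvariant_of_compactSpace (haarU k)
  let φ : Matrix (Fin k) (Fin k) ℂ →ₗ[ℂ] (U k → ℂ) :=
    { toFun := fun M u => star ((u : Matrix (Fin k) (Fin k) ℂ) 0) ⬝ᵥ
        (M *ᵥ (u : Matrix (Fin k) (Fin k) ℂ) 0)
      map_add' := fun A B => by ext u; simp [add_mulVec]
      map_smul' := fun c A => by ext u; simp [smul_mulVec] }
  have hrow : ∀ u h : U k, ((u * h : U k) : Matrix (Fin k) (Fin k) ℂ) 0 =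
      (u : Matrix (Fin k) (Fin k) ℂ) 0 ᵥ* (h : Matrix (Fin k) (Fin k) ℂ) := fun u h => rfl
  have hinv : ∀ f ∈ LinearMap.range φ, ∀ h : U k, (fun u => f (u * h)) ∈ LinearMap.range φ := by
    rintro _ ⟨A, rfl⟩ h
    refine ⟨(h : Matrix (Fin k) (Fin k) ℂ)ᵀᴴ * A * (h : Matrix (Fin k) (Fin k) ℂ)ᵀ, ?_⟩
    ext u
    simp only [φ, LinearMap.coe_mk, AddHom.coe_mk, hrow, ← mulVec_transpose, star_mulVec,
      dotProduct_mulVec]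
    simp
  obtain ⟨u, V, hV, huV⟩ := exists_vanish_on_translate_closure (haarU k) (LinearMap.range φ) hinv
    hS hpos.ne' ⟨M, rfl⟩ h
  refine eq_zero_of_quadraticForm_unit fun y hy => ?_
  have hu : star ((u : Matrix (Fin k) (Fin k) ℂ) 0) ⬝ᵥ (u : Matrix (Fin k) (Fin k) ℂ) 0 = 1 := by
    have := congrFun (congrFun (Matrix.mem_unitaryGroup_iff.mp u.2) 0) 0
    rw [dotProduct_comm]
    simpa [mul_apply, dotProduct] using this
  obtain ⟨P, hP, hPP, ζ, hζ⟩ := exists_scalarOnRange_vecMul_eq hu hy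
  have := huV _ (circleHom_mem_closure _ (continuous_scalarOnRange P hP hPP) hV ζ)
  simpa [φ, hrow, hζ] using this

/-! ### Randomized Kraus operators and orthogonal trajectories. -/

theorem mem_of_ae_pi_mem_of_mem_support {Ω : Type*} [TopologicalSpace Ω] [MeasurableSpace Ω]
    {p : ℕ} (κ : Measure Ω) [SigmaFinite κ] {C : Set (Fin p → Ω)}
    (hC : IsClosed C) (h : ∀ᵐ ω ∂(Measure.pi fun _ : Fin p => κ), ω ∈ C) {ω : Fin p → Ω}
    (hω : ∀ i, ω i ∈ κ.support) : ω ∈ C := by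
  by_contra hn
  obtain ⟨u, hu, huC⟩ := isOpen_pi_iff'.mp hC.isOpen_compl ω hn
  have h0 : Measure.pi (fun _ : Fin p => κ) (Set.univ.pi u) = 0 :=
    measure_mono_null huC h
  rw [Measure.pi_pi, Finset.prod_eq_zero_iff] at h0
  obtain ⟨i, -, hi⟩ := h0
  exact ((Measure.mem_support_iff_forall _).mp (hω i) (u i)
    ((hu i).1.mem_nhds (hu i).2)).ne' hi

theorem integrable_of_continuous_U {k : ℕ} {f : U k → ℂ} (hf : Continuous f) (κ : Measure (U k))
    [IsFiniteMeasure κ] : Integrable f κ :=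
  hf.integrable_of_hasCompactSupport (HasCompactSupport.of_compactSpace f)

section

variable {d k : ℕ} [NeZero k]

theorem continuous_krausAt (v : Fin k → Matrix (Fin d) (Fin d) ℂ) : Continuous (krausAt v) := by
  unfold krausAt
  refine continuous_finsetSum _ fun j _ => ?_
  have h : Continuous fun u : U k => (u : Matrix (Fin k) (Fin k) ℂ) 0 j :=
    (continuous_apply j).comp ((continuous_apply 0).comp continuous_subtype_val)
  exact h.smul continuous_const

/-- Left multiplication by `r i` moves row `i` of `u` to the top, so the sum over `i` sees the
orthonormal columns of `u`. The normalization therefore holds pointwise in `u`, whatever `lam` is.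
-/
theorem sum_krausAt_rowSelector_mul (v : Fin k → Matrix (Fin d) (Fin d) ℂ) {r : Fin k → U k}
    (hr : IsRowSelector r) (hv : ∑ i, (v i)ᴴ * v i = 1) (u : U k) :
    ∑ i, (krausAt v (r i * u))ᴴ * krausAt v (r i * u) = 1 := by
  have hrow : ∀ i, krausAt v (r i * u) = ∑ j, (u : Matrix (Fin k) (Fin k) ℂ) i j • v j := by
    intro i
    simp [krausAt, mul_apply, hr i]
  have horth : ∀ a b, ∑ i, star ((u : Matrix (Fin k) (Fin k) ℂ) i a) *
      (u : Matrix (Fin k) (Fin k) ℂ) i b = if a = b then 1 else 0 := by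
    intro a b
    have := congrFun (congrFun (Matrix.mem_unitaryGroup_iff'.mp u.2) a) b
    simpa [mul_apply, one_apply] using this
  calc ∑ i, (krausAt v (r i * u))ᴴ * krausAt v (r i * u)
      = ∑ i, ∑ a, ∑ b, (star ((u : Matrix (Fin k) (Fin k) ℂ) i a) *
          (u : Matrix (Fin k) (Fin k) ℂ) i b) • ((v a)ᴴ * v b) := by
        simp only [hrow, conjTranspose_sum, conjTranspose_smul, Finset.sum_mul, Finset.mul_sum,
          smul_mul_smul_comm]
        exact Finset.sum_congr rfl fun i _ => Finset.sum_comm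
    _ = ∑ a, ∑ b, (∑ i, star ((u : Matrix (Fin k) (Fin k) ℂ) i a) *
          (u : Matrix (Fin k) (Fin k) ℂ) i b) • ((v a)ᴴ * v b) := by
        rw [Finset.sum_comm]
        refine Finset.sum_congr rfl fun a _ => ?_
        rw [Finset.sum_comm]
        simp [Finset.sum_smul]
    _ = 1 := by simp only [horth]; simp [hv]

theorem continuous_krausAt_conjTranspose_mul_self_apply (v : Fin k → Matrix (Fin d) (Fin d) ℂ)
    (i j : Fin d) : Continuous fun u => ((krausAt v u)ᴴ * krausAt v u) i j := by
  have h := continuous_krausAt v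
  exact (continuous_apply j).comp ((continuous_apply i).comp
    (h.matrix_conjTranspose.matrix_mul h))

theorem integral_outcomeMeasure (v : Fin k → Matrix (Fin d) (Fin d) ℂ) {r : Fin k → U k}
    (hr : IsRowSelector r) (hv : ∑ i, (v i)ᴴ * v i = 1) (lam : Measure (U k))
    [IsProbabilityMeasure lam] (a b : Fin d) :
    ∫ u, ((krausAt v u)ᴴ * krausAt v u) a b ∂(outcomeMeasure r lam) =
      (1 : Matrix (Fin d) (Fin d) ℂ) a b := by
  have hc := continuous_krausAt_conjTranspose_mul_self_apply v a b
  unfold outcomeMeasure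
  rw [integral_finsetSum_measure fun i _ => integrable_of_continuous_U hc _]
  have hmap : ∀ i, ∫ u, ((krausAt v u)ᴴ * krausAt v u) a b ∂(lam.map fun u => r i * u) =
      ∫ u, ((krausAt v (r i * u))ᴴ * krausAt v (r i * u)) a b ∂lam := fun i =>
    integral_map (measurable_const_mul (r i)).aemeasurable hc.aestronglyMeasurable
  simp only [hmap]
  have hint : ∀ i, Integrable
      (fun u => ((krausAt v (r i * u))ᴴ * krausAt v (r i * u)) a b) lam := fun i =>
    integrable_of_continuous_U (hc.comp (continuous_const_mul (r i))) lam
  rw [← integral_finsetSum _ fun i _ => hint i]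
  have hsum : ∀ u : U k, ∑ i, ((krausAt v (r i * u))ᴴ * krausAt v (r i * u)) a b =
      (1 : Matrix (Fin d) (Fin d) ℂ) a b := fun u => by
    rw [← sum_krausAt_rowSelector_mul v hr hv u, Matrix.sum_apply]
  simp [hsum]

/-- All trajectories with outcomes in `S` map `x` and `y` to orthogonal vectors. -/
def TrajectoryOrthogonal (v : Fin k → Matrix (Fin d) (Fin d) ℂ) (S : Set (U k))
    (x y : Fin d → ℂ) : Prop :=
  ∀ L : List (U k), (∀ u ∈ L, u ∈ S) →
    star ((L.map (krausAt v)).reverse.prod *ᵥ x) ⬝ᵥ ((L.map (krausAt v)).reverse.prod *ᵥ y) = 0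

variable {v : Fin k → Matrix (Fin d) (Fin d) ℂ} {S : Set (U k)} {x y : Fin d → ℂ}

theorem TrajectoryOrthogonal.dotProduct_eq_zero (h : TrajectoryOrthogonal v S x y) :
    star x ⬝ᵥ y = 0 := by
  simpa using h [] (by simp)

/-- Since the quadratic forms in the first row of `u` vanishing on `S` are zero, orthogonality
propagates to the images by any two Kraus operators. -/
theorem TrajectoryOrthogonal.mulVec (hS : IsClosed S) (hpos : 0 < haarU k S)
    (h : TrajectoryOrthogonal v S x y) (a b : Fin k) :
    TrajectoryOrthogonal v S (v a *ᵥ x) (v b *ᵥ y) := by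
  intro L hL
  set W := (L.map (krausAt v)).reverse.prod with hW
  let M : Matrix (Fin k) (Fin k) ℂ :=
    Matrix.of fun a b => star (W *ᵥ (v a *ᵥ x)) ⬝ᵥ (W *ᵥ (v b *ᵥ y))
  have hM : M = 0 := by
    refine rowForm_eq_zero hS hpos fun u hu => ?_
    -- The products are reversed, so the head `u` acts first and `W` is applied after `krausAt v u`.
    have := h (u :: L) (List.forall_mem_cons.mpr ⟨hu, hL⟩)
    simp only [List.map_cons, List.reverse_cons, List.prod_append, List.prod_singleton, ← hW,
      ← mulVec_mulVec] at this
    have hk : ∀ z : Fin d → ℂ, W *ᵥ (krausAt v u *ᵥ z) =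
        ∑ j, (u : Matrix (Fin k) (Fin k) ℂ) 0 j • (W *ᵥ (v j *ᵥ z)) := by
      intro z
      simp [krausAt, sum_mulVec, smul_mulVec, mulVec_sum, mulVec_smul]
    rw [hk, hk] at this
    simp only [star_sum, star_smul, sum_dotProduct, smul_dotProduct, dotProduct_sum,
      dotProduct_smul] at this
    rw [← this]
    change ∑ a, star ((u : Matrix (Fin k) (Fin k) ℂ) 0 a) *
      ∑ b, star (W *ᵥ (v a *ᵥ x)) ⬝ᵥ (W *ᵥ (v b *ᵥ y)) * (u : Matrix (Fin k) (Fin k) ℂ) 0 b = _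
    simp only [smul_eq_mul, Finset.mul_sum]
    rw [Finset.sum_comm]
    refine Finset.sum_congr rfl fun a _ => Finset.sum_congr rfl fun b _ => ?_
    ring
  exact congrFun (congrFun hM a) b

theorem trajectoryOrthogonal_of_ae (κ : Measure (U k)) [SigmaFinite κ]
    {P : Matrix (Fin d) (Fin d) ℂ} (hP : Pᴴ = P)
    (h : ∀ p : ℕ, 1 ≤ p → ∀ᵐ ω ∂(Measure.pi fun _ : Fin p => κ),
      ∃ c : ℂ, P * (trajectoryProd (krausAt v) ω)ᴴ * trajectoryProd (krausAt v) ω * P = c • P)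
    (hx : P *ᵥ x = x) (hy : P *ᵥ y = y) (hxy : star x ⬝ᵥ y = 0) :
    TrajectoryOrthogonal v κ.support x y := by
  intro L hL
  -- The purification identity is available only for `p ≥ 1`; the empty trajectory is orthogonality
  -- of `x` and `y`.
  by_cases hL0 : L = []
  · simpa [hL0] using hxy
  have hprod : ∀ ω : Fin L.length → U k, trajectoryProd (krausAt v) ω =
      ((List.ofFn ω).map (krausAt v)).reverse.prod := by
    intro ω
    simp [trajectoryProd, List.map_ofFn, Function.comp_def]
  have hcont : Continuous fun ω : Fin L.length → U k => trajectoryProd (krausAt v) ω := by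
    simp only [trajectoryProd, List.ofFn_eq_map, ← List.map_reverse]
    exact continuous_list_prod _ fun i _ => (continuous_krausAt v).comp (continuous_apply i)
  have hclosed : IsClosed {ω : Fin L.length → U k | star (trajectoryProd (krausAt v) ω *ᵥ x) ⬝ᵥ
      (trajectoryProd (krausAt v) ω *ᵥ y) = 0} := by
    refine isClosed_eq ?_ continuous_const
    exact (hcont.matrix_mulVec continuous_const).star.dotProduct
      (hcont.matrix_mulVec continuous_const)
  have hmem := mem_of_ae_pi_mem_of_mem_support κ (ω := L.get) hclosed ?_
    (fun i => hL _ (List.get_mem L i))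
  · have hmem' : star (trajectoryProd (krausAt v) L.get *ᵥ x) ⬝ᵥ
        (trajectoryProd (krausAt v) L.get *ᵥ y) = 0 := hmem
    rwa [hprod, List.ofFn_get] at hmem'
  · filter_upwards [h L.length (List.length_pos_iff.mpr hL0)] with ω ⟨c, hω⟩
    set W := trajectoryProd (krausAt v) ω
    change star (W *ᵥ x) ⬝ᵥ (W *ᵥ y) = 0
    calc star (W *ᵥ x) ⬝ᵥ (W *ᵥ y) = star (W *ᵥ (P *ᵥ x)) ⬝ᵥ (W *ᵥ (P *ᵥ y)) := by rw [hx, hy]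
      _ = star x ⬝ᵥ ((P * Wᴴ * W * P) *ᵥ y) := by
        simp only [star_mulVec, dotProduct_mulVec, vecMul_vecMul, hP, Matrix.mul_assoc]
      _ = 0 := by rw [hω, smul_mulVec, hy, dotProduct_smul, hxy, smul_zero]

end

/-! ### Asymptotics of linear contractions. -/

/-- The span of the eigenvectors associated with eigenvalues of modulus one. -/
def peripheralSubspace {E : Type*} [AddCommGroup E] [Module ℂ E]
    (T : Module.End ℂ E) : Submodule ℂ E :=
  Submodule.span ℂ {x | ∃ ω : ℂ, ‖ω‖ = 1 ∧ T x = ω • x}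

section Contraction

variable {E : Type*} [NormedAddCommGroup E] [NormedSpace ℂ E] {T : Module.End ℂ E}

theorem norm_pow_apply_le (hT : ∀ x, ‖T x‖ ≤ ‖x‖) (q : ℕ) (x : E) : ‖(T ^ q) x‖ ≤ ‖x‖ := by
  induction q with
  | zero => simp
  | succ q ih => rw [pow_succ', Module.End.mul_apply]; exact (hT _).trans ih

theorem pow_apply_mem_peripheralSubspace {x : E} (hx : x ∈ peripheralSubspace T) (q : ℕ) :
    (T ^ q) x ∈ peripheralSubspace T := by
  induction q with
  | zero => simpa
  | succ q ih =>
    rw [pow_succ', Module.End.mul_apply]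
    revert ih
    generalize (T ^ q) x = y
    intro hy
    induction hy using Submodule.span_induction with
    | mem x hx =>
      obtain ⟨ω, hω, h⟩ := hx
      rw [h]
      exact Submodule.smul_mem _ _ (Submodule.subset_span ⟨ω, hω, h⟩)
    | zero => simp
    | add x y _ _ hx hy => rw [map_add]; exact add_mem hx hy
    | smul c x _ hx => rw [map_smul]; exact Submodule.smul_mem _ _ hx

/-- The norms decrease to a limit `l`. Since `T x` differs from `ω • x` by a vector of lower order,
whose orbit tends to zero by induction, `l ≤ ‖ω‖ * l`. -/
theorem tendsto_pow_apply_zero_of_norm_lt_one (hT : ∀ x, ‖T x‖ ≤ ‖x‖) {ω : ℂ} (hω : ‖ω‖ < 1)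
    (m : ℕ) : ∀ x : E, ((T - ω • 1) ^ m) x = 0 →
      Tendsto (fun q : ℕ => (T ^ q) x) atTop (𝓝 0) := by
  induction m with
  | zero =>
    intro x hx
    have : x = 0 := by simpa using hx
    simp [this]
  | succ m ih =>
    intro x hx
    have hy := ih ((T - ω • 1) x) (by rw [← Module.End.mul_apply, ← pow_succ]; exact hx)
    have hanti : Antitone fun q : ℕ => ‖(T ^ q) x‖ := by
      refine antitone_nat_of_succ_le fun q => ?_
      rw [pow_succ', Module.End.mul_apply]
      exact hT _
    have hlim := tendsto_atTop_ciInf hanti ⟨0, by rintro _ ⟨q, rfl⟩; positivity⟩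
    set l := ⨅ q : ℕ, ‖(T ^ q) x‖
    have hl0 : 0 ≤ l := ge_of_tendsto' hlim fun q => norm_nonneg _
    have hle : l ≤ ‖ω‖ * l + 0 := by
      refine le_of_tendsto_of_tendsto' (hlim.comp (tendsto_add_atTop_nat 1))
        ((hlim.const_mul ‖ω‖).add (norm_zero (E := E) ▸ hy.norm)) fun q => ?_
      have : (T ^ (q + 1)) x = ω • (T ^ q) x + (T ^ q) ((T - ω • 1) x) := by
        simp [pow_succ]
      simp only [Function.comp, this]
      exact (norm_add_le _ _).trans_eq (by rw [norm_smul])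
    have : l = 0 := by nlinarith
    rw [this] at hlim
    exact tendsto_zero_iff_norm_tendsto_zero.mpr hlim

/-- A nontrivial Jordan block at a unimodular eigenvalue would make `‖(T ^ q) x‖` grow linearly in
`q`. -/
theorem sub_smul_apply_eq_zero_of_pow (hT : ∀ x, ‖T x‖ ≤ ‖x‖) {ω : ℂ} (hω : ‖ω‖ = 1)
    (m : ℕ) : ∀ x : E, ((T - ω • 1) ^ m) x = 0 → (T - ω • 1) x = 0 := by
  have hsq : ∀ x : E, (T - ω • 1) ((T - ω • 1) x) = 0 → (T - ω • 1) x = 0 := by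
    intro x hx
    set y := (T - ω • 1) x with hy
    have hTx : T x = ω • x + y := by simp [hy]
    have hTy : T y = ω • y := by simpa [sub_eq_zero] using hx
    have hpow : ∀ q : ℕ, ω • (T ^ q) x = ω ^ (q + 1) • x + ((q : ℂ) * ω ^ q) • y := by
      intro q
      induction q with
      | zero => simp
      | succ q ih =>
        rw [pow_succ', Module.End.mul_apply, ← map_smul, ih, map_add, map_smul, map_smul, hTx, hTy]
        push_cast
        module
    have hbound : ∀ q : ℕ, q * ‖y‖ ≤ 2 * ‖x‖ := by
      intro q
      have h1 : ((q : ℂ) * ω ^ q) • y = ω • (T ^ q) x - ω ^ (q + 1) • x := by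
        rw [hpow q]; abel
      have h2 := congrArg norm h1
      rw [norm_smul, norm_mul, norm_pow, hω, one_pow, mul_one, Complex.norm_natCast] at h2
      rw [h2]
      refine (norm_sub_le _ _).trans ?_
      rw [norm_smul, norm_smul, norm_pow, hω, one_pow]
      linarith [norm_pow_apply_le hT q x]
    by_contra hne
    have hpos : 0 < ‖y‖ := norm_pos_iff.mpr hne
    obtain ⟨q, hq⟩ := exists_nat_gt (2 * ‖x‖ / ‖y‖)
    rw [div_lt_iff₀ hpos] at hq
    exact absurd (hbound q) (not_le.mpr hq)
  induction m with
  | zero =>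
    intro x hx
    have : x = 0 := by simpa using hx
    simp [this]
  | succ m ih =>
    intro x hx
    refine hsq x (ih _ ?_)
    rw [← Module.End.mul_apply, ← pow_succ]; exact hx

theorem eq_zero_of_pow_of_one_lt_norm (hT : ∀ x, ‖T x‖ ≤ ‖x‖) {ω : ℂ} (hω : 1 < ‖ω‖)
    (m : ℕ) : ∀ x : E, ((T - ω • 1) ^ m) x = 0 → x = 0 := by
  induction m with
  | zero => intro x hx; simpa using hx
  | succ m ih =>
    intro x hx
    have h := ih ((T - ω • 1) x) (by rw [← Module.End.mul_apply, ← pow_succ]; exact hx)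
    have hTx : T x = ω • x := by simpa [sub_eq_zero] using h
    have h1 := hT x
    rw [hTx, norm_smul] at h1
    by_contra hne
    have := norm_pos_iff.mpr hne
    nlinarith

/-- Under a linear contraction, every vector is asymptotic to a combination of eigenvectors
associated with eigenvalues of modulus one. -/
theorem exists_mem_peripheralSubspace_tendsto [FiniteDimensional ℂ E] (hT : ∀ x, ‖T x‖ ≤ ‖x‖)
    (x : E) : ∃ y ∈ peripheralSubspace T,
      Tendsto (fun q : ℕ => (T ^ q) (x - y)) atTop (𝓝 0) := by
  have hx : x ∈ ⨆ ω : ℂ, T.maxGenEigenspace ω := by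
    rw [Module.End.iSup_maxGenEigenspace_eq_top]; trivial
  induction hx using Submodule.iSup_induction' with
  | mem ω x hx =>
    obtain ⟨m, hm⟩ := Module.End.mem_maxGenEigenspace T ω x |>.mp hx
    rcases lt_trichotomy ‖ω‖ 1 with h | h | h
    · exact ⟨0, zero_mem _, by simpa using tendsto_pow_apply_zero_of_norm_lt_one hT h m x hm⟩
    · refine ⟨x, Submodule.subset_span ⟨ω, h, ?_⟩, by simp⟩
      simpa [sub_eq_zero] using sub_smul_apply_eq_zero_of_pow hT h m x hm
    · exact ⟨0, zero_mem _, by simp [eq_zero_of_pow_of_one_lt_norm hT h m x hm]⟩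
  | zero => exact ⟨0, zero_mem _, by simp⟩
  | add x₁ x₂ _ _ h₁ h₂ =>
    obtain ⟨y₁, hy₁, h₁⟩ := h₁
    obtain ⟨y₂, hy₂, h₂⟩ := h₂
    refine ⟨y₁ + y₂, add_mem hy₁ hy₂, ?_⟩
    have := h₁.add h₂
    simpa only [← map_add, add_zero, sub_add_sub_comm] using this

/-- If `T ^ q` maps a bounded sequence `x q` into the fiber of a linear map over a fixed point,
then this fiber meets the peripheral subspace. -/
theorem exists_mem_peripheralSubspace_apply_eq [FiniteDimensional ℂ E]
    (hT : ∀ x, ‖T x‖ ≤ ‖x‖) {F : Type*} [NormedAddCommGroup F] [NormedSpace ℂ F]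
    [FiniteDimensional ℂ F] (A : E →ₗ[ℂ] F) (b : F) {C : ℝ}
    (h : ∀ q : ℕ, ∃ x : E, ‖x‖ ≤ C ∧ A ((T ^ q) x) = b) :
    ∃ y ∈ peripheralSubspace T, A y = b := by
  choose x hxC hxb using h
  have : ProperSpace E := FiniteDimensional.proper ℂ E
  obtain ⟨a, -, φ, hφ, hlim⟩ := tendsto_subseq_of_bounded
    (Metric.isBounded_closedBall (x := (0 : E)) (r := C)) (fun q => by simpa using hxC q)
  obtain ⟨y, hy, hylim⟩ := exists_mem_peripheralSubspace_tendsto hT a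
  have h1 : Tendsto (fun q => (T ^ φ q) (x (φ q) - y)) atTop (𝓝 0) := by
    have h2 : Tendsto (fun q => (T ^ φ q) (x (φ q) - a)) atTop (𝓝 0) := by
      refine squeeze_zero_norm (fun q => norm_pow_apply_le hT _ _) ?_
      exact tendsto_iff_norm_sub_tendsto_zero.mp hlim
    have := h2.add (hylim.comp hφ.tendsto_atTop)
    simpa only [Function.comp, ← map_add, add_zero, sub_add_sub_cancel] using this
  have hA : Continuous A := A.continuous_of_finiteDimensional
  have h3 : Tendsto (fun q => A ((T ^ φ q) y)) atTop (𝓝 b) := by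
    have h4 := ((hA.tendsto 0).comp h1).const_sub b
    refine Tendsto.congr (fun q => ?_) (by simpa using h4)
    simp [hxb]
  -- The vectors `(T ^ φ q) y` stay in the peripheral subspace, whose image under `A` is closed, so
  -- their limit value `b` is attained there.
  have hclosed : IsClosed (((peripheralSubspace T).map A : Submodule ℂ F) : Set F) :=
    Submodule.closed_of_finiteDimensional _
  have := hclosed.mem_of_tendsto h3 (Eventually.of_forall fun q =>
    Submodule.mem_map_of_mem (pow_apply_mem_peripheralSubspace hy _))
  simpa using this

end Contraction

/-! ### Peripheral eigenvectors of an irreducible channel. -/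

section Kraus

open scoped MatrixOrder Matrix.Norms.L2Operator

variable {d k : ℕ} {Φ : Matrix (Fin d) (Fin d) ℂ →ₗ[ℂ] Matrix (Fin d) (Fin d) ℂ}
  {v : Fin k → Matrix (Fin d) (Fin d) ℂ}

theorem IsKrausDecomposition.sum_eq_one (hv : IsKrausDecomposition Φ v) (h1 : Φ 1 = 1) :
    ∑ i, (v i)ᴴ * v i = 1 := by
  have := hv 1
  rw [h1] at this
  simpa using this.symm

theorem IsKrausDecomposition.map_nonneg (hv : IsKrausDecomposition Φ v)
    {X : Matrix (Fin d) (Fin d) ℂ} (hX : 0 ≤ X) : 0 ≤ Φ X := by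
  rw [hv X]
  exact Finset.sum_nonneg fun i _ => star_left_conjugate_nonneg hX (v i)

theorem IsKrausDecomposition.map_mono (hv : IsKrausDecomposition Φ v)
    {X Y : Matrix (Fin d) (Fin d) ℂ} (hXY : X ≤ Y) : Φ X ≤ Φ Y := by
  rw [← sub_nonneg, ← map_sub]
  exact hv.map_nonneg (sub_nonneg.mpr hXY)

theorem IsKrausDecomposition.map_star (hv : IsKrausDecomposition Φ v)
    (X : Matrix (Fin d) (Fin d) ℂ) : Φ Xᴴ = (Φ X)ᴴ := by
  simp [hv _, conjTranspose_sum, Matrix.mul_assoc]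

/-- The defect in the Kadison–Schwarz inequality as a sum of squares. -/
theorem IsKrausDecomposition.schwarz_defect (hv : IsKrausDecomposition Φ v) (h1 : Φ 1 = 1)
    (X : Matrix (Fin d) (Fin d) ℂ) :
    Φ (Xᴴ * X) - (Φ X)ᴴ * Φ X = ∑ i, (X * v i - v i * Φ X)ᴴ * (X * v i - v i * Φ X) := by
  have hsum := hv.sum_eq_one h1
  have hX : ∑ i, (v i)ᴴ * X * v i = Φ X := (hv X).symm
  have hX' : ∑ i, (v i)ᴴ * Xᴴ * v i = (Φ X)ᴴ := by rw [← hv.map_star, hv]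
  have expand : ∀ i, (X * v i - v i * Φ X)ᴴ * (X * v i - v i * Φ X) =
      (v i)ᴴ * (Xᴴ * X) * v i - ((v i)ᴴ * Xᴴ * v i) * Φ X - (Φ X)ᴴ * ((v i)ᴴ * X * v i)
        + (Φ X)ᴴ * ((v i)ᴴ * v i) * Φ X := by
    intro i
    simp only [conjTranspose_sub, conjTranspose_mul]
    noncomm_ring
  simp only [expand, Finset.sum_add_distrib, Finset.sum_sub_distrib, ← Finset.sum_mul,
    ← Finset.mul_sum, hsum, hX, hX', ← hv (Xᴴ * X)]
  noncomm_ring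

theorem IsKrausDecomposition.schwarz (hv : IsKrausDecomposition Φ v) (h1 : Φ 1 = 1)
    (X : Matrix (Fin d) (Fin d) ℂ) : (Φ X)ᴴ * Φ X ≤ Φ (Xᴴ * X) := by
  rw [← sub_nonneg, hv.schwarz_defect h1]
  exact Finset.sum_nonneg fun i _ => star_mul_self_nonneg _

theorem IsKrausDecomposition.norm_map_le (hv : IsKrausDecomposition Φ v) (h1 : Φ 1 = 1)
    (X : Matrix (Fin d) (Fin d) ℂ) : ‖Φ X‖ ≤ ‖X‖ := by
  have halg : ∀ r : ℝ, Φ (algebraMap ℝ (Matrix (Fin d) (Fin d) ℂ) r) = algebraMap ℝ _ r := by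
    intro r
    have : algebraMap ℝ (Matrix (Fin d) (Fin d) ℂ) r = (r : ℂ) • 1 := by
      rw [IsScalarTower.algebraMap_apply ℝ ℂ, Algebra.algebraMap_eq_smul_one]; rfl
    rw [this, map_smul, h1]
  have h : star (Φ X) * Φ X ≤ algebraMap ℝ _ (‖X‖ ^ 2) := by
    refine (hv.schwarz h1 X).trans ?_
    rw [← halg]
    exact hv.map_mono CStarAlgebra.star_mul_le_algebraMap_norm_sq
  have h2 := (CStarAlgebra.norm_le_iff_le_algebraMap (star (Φ X) * Φ X) (by positivity)
    (star_mul_self_nonneg _)).mpr h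
  rw [CStarRing.norm_star_mul_self, ← pow_two] at h2
  exact (sq_le_sq₀ (norm_nonneg _) (norm_nonneg _)).mp h2

/-- For an irreducible unital positive map, subharmonic elements are harmonic. -/
theorem IsKrausDecomposition.map_eq_of_le_map (hv : IsKrausDecomposition Φ v) (h1 : Φ 1 = 1)
    (hirr : IsIrreducible Φ) {A : Matrix (Fin d) (Fin d) ℂ} (hA : A ≤ Φ A) : Φ A = A := by
  obtain ⟨n, -, hn⟩ := hirr
  by_contra hne
  have hnt : Nontrivial (Matrix (Fin d) (Fin d) ℂ) := ⟨_, _, hne⟩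
  set s : Module.End ℂ (Matrix (Fin d) (Fin d) ℂ) := (1 + Φ) ^ n with hs
  have hcomm : Commute s Φ := ((Commute.one_left Φ).add_left (Commute.refl Φ)).pow_left n
  have hD : (s (Φ A - A)).PosDef := hn _ (Matrix.le_iff.mp hA) (sub_ne_zero.mpr hne)
  have hD' := Matrix.isStrictlyPositive_iff_posDef.mpr hD
  obtain ⟨ε, hε, hεD⟩ := (CFC.exists_pos_algebraMap_le_iff hD'.isSelfAdjoint).mpr
    fun x hx => hD'.spectrum_pos hx
  have halg : ∀ r : ℝ, algebraMap ℝ (Matrix (Fin d) (Fin d) ℂ) r = (r : ℂ) • 1 := fun r => by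
    rw [IsScalarTower.algebraMap_apply ℝ ℂ, Algebra.algebraMap_eq_smul_one]; rfl
  rw [halg] at hεD
  -- As `s` commutes with `Φ`, these increments telescope to `Φ ^ q (s A) - s A ≥ q ε`, which the
  -- contraction property forbids for large `q`.
  have hstep : ∀ q : ℕ, (ε : ℂ) • 1 ≤ (Φ ^ q) (s (Φ A - A)) := by
    intro q
    induction q with
    | zero => simpa using hεD
    | succ q ih =>
      rw [pow_succ', Module.End.mul_apply]
      refine le_trans (le_of_eq ?_) (hv.map_mono ih)
      rw [map_smul, h1]
  have htel : ∀ q : ℕ, ((q * ε : ℝ) : ℂ) • 1 ≤ (Φ ^ q) (s A) - s A := by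
    intro q
    induction q with
    | zero => simp
    | succ q ih =>
      have heq : (Φ ^ (q + 1)) (s A) - s A =
          (Φ ^ q) (s (Φ A - A)) + ((Φ ^ q) (s A) - s A) := by
        have : s (Φ A) = Φ (s A) := LinearMap.congr_fun hcomm.eq A
        rw [map_sub, map_sub, this, pow_succ, Module.End.mul_apply]
        abel
      have hcast : (((q + 1 : ℕ) * ε : ℝ) : ℂ) • (1 : Matrix (Fin d) (Fin d) ℂ) =
          (ε : ℂ) • 1 + ((q * ε : ℝ) : ℂ) • 1 := by
        push_cast; module
      rw [heq, hcast]
      exact add_le_add (hstep q) ih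
  have hbound : ∀ q : ℕ, q * ε ≤ 2 * ‖s A‖ := by
    intro q
    have h0 : (0 : Matrix (Fin d) (Fin d) ℂ) ≤ ((q * ε : ℝ) : ℂ) • 1 := by
      rw [← halg]
      exact algebraMap_nonneg _ (by positivity)
    have h2 := CStarAlgebra.norm_le_norm_of_nonneg_of_le h0 (htel q)
    rw [norm_smul, norm_one, mul_one, Complex.norm_real] at h2
    have h3 := norm_pow_apply_le (hv.norm_map_le h1) q (s A)
    have h4 := norm_sub_le ((Φ ^ q) (s A)) (s A)
    linarith [Real.le_norm_self (q * ε)]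
  obtain ⟨q, hq⟩ := exists_nat_gt (2 * ‖s A‖ / ε)
  rw [div_lt_iff₀ hε] at hq
  exact absurd (hbound q) (not_le.mpr hq)

/-- `X` commutes with all Kraus operators up to the phase `ω`. -/
def IsPhaseCommuting (v : Fin k → Matrix (Fin d) (Fin d) ℂ) (ω : ℂ)
    (X : Matrix (Fin d) (Fin d) ℂ) : Prop :=
  ∀ i, X * v i = ω • (v i * X)

/-- By Kadison–Schwarz `Xᴴ * X` is subharmonic, hence harmonic. The Schwarz defect then vanishes,
and so does each of its squares. -/
theorem IsKrausDecomposition.isPhaseCommuting_of_map_eq (hv : IsKrausDecomposition Φ v)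
    (h1 : Φ 1 = 1) (hirr : IsIrreducible Φ) {ω : ℂ} (hω : ‖ω‖ = 1)
    {X : Matrix (Fin d) (Fin d) ℂ} (hX : Φ X = ω • X) : IsPhaseCommuting v ω X := by
  have hXX : (Φ X)ᴴ * Φ X = Xᴴ * X := by
    rw [hX, conjTranspose_smul, smul_mul_smul_comm]
    have : star ω * ω = 1 := by
      simpa [hω] using Complex.conj_mul' ω
    rw [this, one_smul]
  have hle : Xᴴ * X ≤ Φ (Xᴴ * X) := hXX ▸ hv.schwarz h1 X
  have hD := hv.schwarz_defect h1 X
  rw [hXX, hv.map_eq_of_le_map h1 hirr hle, sub_self] at hD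
  intro i
  have h0 := (Finset.sum_eq_zero_iff_of_nonneg fun i _ =>
    star_mul_self_nonneg (X * v i - v i * Φ X)).mp hD.symm i (Finset.mem_univ i)
  have h2 : X * v i - v i * Φ X = 0 := conjTranspose_mul_self_eq_zero.mp h0
  rw [sub_eq_zero.mp h2, hX, mul_smul_comm]

theorem IsPhaseCommuting.map_eq {ω : ℂ} {X : Matrix (Fin d) (Fin d) ℂ}
    (hX : IsPhaseCommuting v ω X) (hv : IsKrausDecomposition Φ v) (h1 : Φ 1 = 1) :
    Φ X = ω • X := by
  calc Φ X = ∑ i, ω • ((v i)ᴴ * v i * X) := by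
        rw [hv]
        refine Finset.sum_congr rfl fun i _ => ?_
        rw [Matrix.mul_assoc, hX i, mul_smul_comm, Matrix.mul_assoc]
    _ = ω • X := by rw [← Finset.smul_sum, ← Finset.sum_mul, hv.sum_eq_one h1, one_mul]

/-- The phases cancel in `Xᴴ * X`, so `Φ` fixes it and `(1 + Φ) ^ n` only multiplies it by `2 ^ n`;
irreducibility makes it positive definite. -/
theorem IsPhaseCommuting.isUnit {ω : ℂ} {X : Matrix (Fin d) (Fin d) ℂ}
    (hX : IsPhaseCommuting v ω X) (hv : IsKrausDecomposition Φ v) (h1 : Φ 1 = 1)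
    (hirr : IsIrreducible Φ) (hω : ‖ω‖ = 1) (hX0 : X ≠ 0) : IsUnit X := by
  obtain ⟨n, -, hn⟩ := hirr
  have hfix : Φ (Xᴴ * X) = Xᴴ * X := by
    have hstar : ∀ i, (v i)ᴴ * Xᴴ = star ω • (Xᴴ * (v i)ᴴ) := fun i => by
      rw [← conjTranspose_mul, hX i, conjTranspose_smul, conjTranspose_mul]
    have : star ω * ω = 1 := by
      simpa [hω] using Complex.conj_mul' ω
    calc Φ (Xᴴ * X) = ∑ i, Xᴴ * ((v i)ᴴ * v i) * X := by
          rw [hv]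
          refine Finset.sum_congr rfl fun i _ => ?_
          rw [← Matrix.mul_assoc, hstar i, Matrix.mul_assoc, hX i, smul_mul_smul_comm, this,
            one_smul]
          simp only [Matrix.mul_assoc]
      _ = Xᴴ * X := by rw [← Finset.sum_mul, ← Finset.mul_sum, hv.sum_eq_one h1, mul_one]
  have hpow : ∀ m : ℕ, ((1 + Φ : Module.End ℂ (Matrix (Fin d) (Fin d) ℂ)) ^ m) (Xᴴ * X) =
      (2 : ℂ) ^ m • (Xᴴ * X) := by
    intro m
    induction m with
    | zero => simp
    | succ m ih =>
      rw [pow_succ', Module.End.mul_apply, ih, map_smul, LinearMap.add_apply,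
        Module.End.one_apply, hfix, ← two_smul ℂ, smul_smul, pow_succ]
  have hpd := hn (Xᴴ * X) (posSemidef_conjTranspose_mul_self X)
    (fun h => hX0 (conjTranspose_mul_self_eq_zero.mp h))
  rw [hpow] at hpd
  have hu := hpd.isUnit
  rw [← smul_mul_assoc] at hu
  exact isUnit_of_mul_isUnit_right hu

theorem IsPhaseCommuting.mul {ω η : ℂ} {X Y : Matrix (Fin d) (Fin d) ℂ}
    (hX : IsPhaseCommuting v ω X) (hY : IsPhaseCommuting v η Y) :
    IsPhaseCommuting v (ω * η) (X * Y) := by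
  intro i
  rw [Matrix.mul_assoc, hY i, mul_smul_comm, ← Matrix.mul_assoc, hX i, smul_mul_assoc, smul_smul,
    Matrix.mul_assoc, mul_comm η]

theorem IsPhaseCommuting.pow {ω : ℂ} {X : Matrix (Fin d) (Fin d) ℂ}
    (hX : IsPhaseCommuting v ω X) (n : ℕ) : IsPhaseCommuting v (ω ^ n) (X ^ n) := by
  induction n with
  | zero => intro i; simp
  | succ n ih => rw [pow_succ, pow_succ]; exact ih.mul hX

theorem IsPhaseCommuting.inv {ω : ℂ} (hω : ω ≠ 0) {X : (Matrix (Fin d) (Fin d) ℂ)ˣ}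
    (hX : IsPhaseCommuting v ω (X : Matrix (Fin d) (Fin d) ℂ)) :
    IsPhaseCommuting v ω⁻¹ ((X⁻¹ : (Matrix (Fin d) (Fin d) ℂ)ˣ) : Matrix (Fin d) (Fin d) ℂ) := by
  intro i
  have h := congrArg (fun Z => (X⁻¹).val * Z * (X⁻¹).val) (hX i)
  simp only [← Matrix.mul_assoc, Units.inv_mul, one_mul, mul_smul_comm, smul_mul_assoc] at h
  rw [Matrix.mul_assoc _ X.val, Units.mul_inv, mul_one] at h
  rw [h, smul_smul, inv_mul_cancel₀ hω, one_smul]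

/-- For an eigenvalue `c` of `X⁻¹ Y`, the matrix `c • X - Y` is singular and has the same phase, so
it must be zero. -/
theorem IsPhaseCommuting.eq_smul {ω : ℂ} {X Y : Matrix (Fin d) (Fin d) ℂ}
    (hX : IsPhaseCommuting v ω X) (hY : IsPhaseCommuting v ω Y) (hv : IsKrausDecomposition Φ v)
    (h1 : Φ 1 = 1) (hirr : IsIrreducible Φ) (hω : ‖ω‖ = 1) (hXu : IsUnit X) :
    ∃ c : ℂ, Y = c • X := by
  rcases subsingleton_or_nontrivial (Matrix (Fin d) (Fin d) ℂ) with hs | hs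
  · exact ⟨0, Subsingleton.elim _ _⟩
  obtain ⟨x, rfl⟩ := hXu
  obtain ⟨c, hc⟩ := spectrum.nonempty_of_isAlgClosed_of_finiteDimensional ℂ ((x⁻¹).val * Y)
  refine ⟨c, ?_⟩
  by_contra hne
  have hZ : IsPhaseCommuting v ω (c • x.val - Y) := fun i => by
    rw [sub_mul, mul_sub, smul_sub, hY i, smul_mul_assoc, hX i, mul_smul_comm, smul_comm]
  have hu := hZ.isUnit hv h1 hirr hω (sub_ne_zero.mpr (Ne.symm hne))
  apply hc
  have : algebraMap ℂ (Matrix (Fin d) (Fin d) ℂ) c - (x⁻¹).val * Y =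
      (x⁻¹).val * (c • x.val - Y) := by
    rw [mul_sub, mul_smul_comm, Units.inv_mul, Algebra.algebraMap_eq_smul_one]
  rw [spectrum.mem_resolventSet_iff, this]
  exact (Units.isUnit _).mul hu

/-- The unimodular phases which occur form a finite subgroup of `ℂˣ`, which is cyclic, and
phase-commuting elements are determined up to scalars by their phase, so they commute. -/
theorem IsPhaseCommuting.commute {ω η : ℂ} {X Y : Matrix (Fin d) (Fin d) ℂ}
    (hX : IsPhaseCommuting v ω X) (hY : IsPhaseCommuting v η Y) (hv : IsKrausDecomposition Φ v)
    (h1 : Φ 1 = 1) (hirr : IsIrreducible Φ) (hω : ‖ω‖ = 1) (hη : ‖η‖ = 1) : Commute X Y := by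
  by_cases hX0 : X = 0
  · rw [hX0]; exact Commute.zero_left Y
  by_cases hY0 : Y = 0
  · rw [hY0]; exact Commute.zero_right X
  have hnt : Nontrivial (Matrix (Fin d) (Fin d) ℂ) := ⟨_, _, hX0⟩
  let S : Subgroup ℂˣ :=
    { carrier := {z | ‖(z : ℂ)‖ = 1 ∧
        ∃ Z : (Matrix (Fin d) (Fin d) ℂ)ˣ, IsPhaseCommuting v (z : ℂ) Z.val}
      mul_mem' := by
        rintro a b ⟨ha, A, hA⟩ ⟨hb, B, hB⟩
        exact ⟨by simp [ha, hb], A * B, hA.mul hB⟩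
      one_mem' := ⟨by simp, 1, fun i => by simp⟩
      inv_mem' := by
        rintro a ⟨ha, A, hA⟩
        exact ⟨by simp [ha], A⁻¹, by simpa using hA.inv a.ne_zero⟩ }
  -- Each phase is an eigenvalue of `Φ`, and there are finitely many of those.
  have hfin : Finite S := by
    have hsub : (fun z : ℂˣ => (z : ℂ)) '' (S : Set ℂˣ) ⊆
        {z | Module.End.HasEigenvalue Φ z} := by
      rintro _ ⟨z, ⟨-, Z, hZ⟩, rfl⟩
      exact Module.End.hasEigenvalue_of_hasEigenvector
        ⟨Module.End.mem_eigenspace_iff.mpr (hZ.map_eq hv h1), Z.ne_zero⟩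
    exact Set.Finite.of_finite_image ((Module.End.finite_hasEigenvalue Φ).subset hsub)
      Units.val_injective.injOn
  have hne : ∀ {z : ℂ}, ‖z‖ = 1 → z ≠ 0 := fun h => norm_ne_zero_iff.mp (by rw [h]; norm_num)
  obtain ⟨⟨g, hg1, W, hW⟩, hgen⟩ := IsCyclic.exists_monoid_generator (α := S)
  have key : ∀ {z : ℂ} {Z : Matrix (Fin d) (Fin d) ℂ}, IsPhaseCommuting v z Z → ‖z‖ = 1 →
      Z ≠ 0 → ∃ (c : ℂ) (n : ℕ), Z = c • W.val ^ n := by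
    intro z Z hZ hz hZ0
    obtain ⟨u, hu⟩ := hZ.isUnit hv h1 hirr hz hZ0
    obtain ⟨n, hn⟩ := hgen ⟨Units.mk0 z (hne hz), hz, u, by rw [hu]; exact hZ⟩
    have hzn : (g : ℂ) ^ n = z := by
      have := congrArg (fun s : S => ((s : ℂˣ) : ℂ)) hn
      simpa using this
    have hWn := hW.pow n
    rw [hzn] at hWn
    obtain ⟨c, hc⟩ := hWn.eq_smul hZ hv h1 hirr hz (W.isUnit.pow n)
    exact ⟨c, n, hc⟩
  obtain ⟨a, m, rfl⟩ := key hX hω hX0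
  obtain ⟨b, n, rfl⟩ := key hY hη hY0
  exact ((Commute.refl W.val).pow_pow m n).smul_left a |>.smul_right b

theorem IsKrausDecomposition.commute_of_mem_peripheralSubspace (hv : IsKrausDecomposition Φ v)
    (h1 : Φ 1 = 1) (hirr : IsIrreducible Φ) {X Y : Matrix (Fin d) (Fin d) ℂ}
    (hX : X ∈ peripheralSubspace Φ) (hY : Y ∈ peripheralSubspace Φ) : Commute X Y := by
  induction hX using Submodule.span_induction with
  | zero => exact Commute.zero_left Y
  | add _ _ _ _ h₁ h₂ => exact h₁.add_left h₂
  | smul c _ _ h => exact h.smul_left c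
  | mem X hX =>
    obtain ⟨ω, hω, hX⟩ := hX
    have hX' := hv.isPhaseCommuting_of_map_eq h1 hirr hω hX
    induction hY using Submodule.span_induction with
    | zero => exact Commute.zero_right X
    | add _ _ _ _ h₁ h₂ => exact h₁.add_right h₂
    | smul c _ _ h => exact h.smul_right c
    | mem Y hY =>
      obtain ⟨η, hη, hY⟩ := hY
      exact hX'.commute (hv.isPhaseCommuting_of_map_eq h1 hirr hη hY) hv h1 hirr hω hη

end Kraus

/-! ### Separating orthogonal trajectories by peripheral observables. -/

section Orbit

open scoped Matrix.Norms.L2Operator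

variable {d k : ℕ} {Φ : Matrix (Fin d) (Fin d) ℂ →ₗ[ℂ] Matrix (Fin d) (Fin d) ℂ}
  {v : Fin k → Matrix (Fin d) (Fin d) ℂ}

/-- The images of a vector under the products of `q` Kraus operators. -/
def krausOrbit (v : Fin k → Matrix (Fin d) (Fin d) ℂ) : ℕ → (Fin d → ℂ) → Set (Fin d → ℂ)
  | 0, z => {z}
  | q + 1, z => ⋃ i, krausOrbit v q (v i *ᵥ z)

/-- In `∑ (v i)ᴴ * (Φ ^ q) X * v i`, the middle factor acts as `c` on each `v i *ᵥ z`, and unitality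
restores `z`. -/
theorem IsKrausDecomposition.pow_mulVec_eq_smul (hv : IsKrausDecomposition Φ v) (h1 : Φ 1 = 1)
    {X : Matrix (Fin d) (Fin d) ℂ} {c : ℂ} (q : ℕ) : ∀ z : Fin d → ℂ,
    (∀ a ∈ krausOrbit v q z, X *ᵥ a = c • a) → (Φ ^ q) X *ᵥ z = c • z := by
  induction q with
  | zero => intro z hz; exact hz z rfl
  | succ q ih =>
    intro z hz
    have h : ∀ i, (Φ ^ q) X *ᵥ (v i *ᵥ z) = c • (v i *ᵥ z) := fun i =>
      ih _ fun a ha => hz a (Set.mem_iUnion.mpr ⟨i, ha⟩)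
    calc (Φ ^ (q + 1)) X *ᵥ z = ∑ i, c • (((v i)ᴴ * v i) *ᵥ z) := by
          rw [pow_succ', Module.End.mul_apply, hv, sum_mulVec]
          refine Finset.sum_congr rfl fun i _ => ?_
          rw [← mulVec_mulVec, ← mulVec_mulVec, h i, mulVec_smul, mulVec_mulVec]
      _ = c • z := by
          rw [← Finset.smul_sum, ← sum_mulVec, hv.sum_eq_one h1, one_mulVec]

theorem TrajectoryOrthogonal.dotProduct_eq_zero_of_mem_krausOrbit [NeZero k] {S : Set (U k)}
    (hS : IsClosed S) (hpos : 0 < haarU k S) (q : ℕ) : ∀ {x y : Fin d → ℂ},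
    TrajectoryOrthogonal v S x y → ∀ a ∈ krausOrbit v q x, ∀ b ∈ krausOrbit v q y,
      star a ⬝ᵥ b = 0 := by
  induction q with
  | zero =>
    rintro x y h a rfl b rfl
    exact h.dotProduct_eq_zero
  | succ q ih =>
    intro x y h a ha b hb
    obtain ⟨i, ha⟩ := Set.mem_iUnion.mp ha
    obtain ⟨j, hb⟩ := Set.mem_iUnion.mp hb
    exact ih (h.mulVec hS hpos i j) a ha b hb

/-- The orthogonal projection onto the span of `A`. The bound `1`, uniform in the word length, is
what the compactness argument needs. -/
theorem exists_norm_le_one_mulVec_eq {A B : Set (Fin d → ℂ)}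
    (h : ∀ a ∈ A, ∀ b ∈ B, star a ⬝ᵥ b = 0) :
    ∃ P : Matrix (Fin d) (Fin d) ℂ, ‖P‖ ≤ 1 ∧ (∀ a ∈ A, P *ᵥ a = a) ∧ ∀ b ∈ B, P *ᵥ b = 0 := by
  let K : Submodule ℂ (EuclideanSpace ℂ (Fin d)) := Submodule.span ℂ (WithLp.toLp 2 '' A)
  have hP : ∀ x : Fin d → ℂ, WithLp.toLp 2
      ((Matrix.toEuclideanCLM (n := Fin d) (𝕜 := ℂ)).symm K.starProjection *ᵥ x) =
      K.starProjection (WithLp.toLp 2 x) := by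
    intro x
    rw [← Matrix.toEuclideanCLM_toLp, StarAlgEquiv.apply_symm_apply]
  refine ⟨(Matrix.toEuclideanCLM (n := Fin d) (𝕜 := ℂ)).symm K.starProjection, ?_,
    fun a ha => ?_, fun b hb => ?_⟩
  · rw [Matrix.cstar_norm_def, StarAlgEquiv.apply_symm_apply]
    exact K.starProjection_norm_le
  · apply WithLp.toLp_injective 2
    rw [hP, Submodule.starProjection_eq_self_iff]
    exact Submodule.subset_span ⟨a, ha, rfl⟩
  · apply WithLp.toLp_injective 2
    rw [hP, WithLp.toLp_zero, Submodule.starProjection_apply_eq_zero_iff,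
      Submodule.mem_orthogonal]
    intro u hu
    induction hu using Submodule.span_induction with
    | mem u hu =>
      obtain ⟨a, ha, rfl⟩ := hu
      rw [EuclideanSpace.inner_toLp_toLp, dotProduct_comm]
      exact h a ha b hb
    | zero => simp
    | add _ _ _ _ h₁ h₂ => rw [inner_add_left, h₁, h₂, add_zero]
    | smul c _ _ h => rw [inner_smul_left, h, mul_zero]

/-- Vectors with orthogonal trajectories are separated by a peripheral observable. -/
theorem TrajectoryOrthogonal.exists_mem_peripheralSubspace [NeZero k] {S : Set (U k)}
    (hS : IsClosed S) (hpos : 0 < haarU k S) (hv : IsKrausDecomposition Φ v) (h1 : Φ 1 = 1)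
    {x y : Fin d → ℂ} (h : TrajectoryOrthogonal v S x y) :
    ∃ X ∈ peripheralSubspace Φ, X *ᵥ x = x ∧ X *ᵥ y = 0 := by
  let A : Matrix (Fin d) (Fin d) ℂ →ₗ[ℂ] (Fin d → ℂ) × (Fin d → ℂ) :=
    { toFun := fun X => (X *ᵥ x, X *ᵥ y)
      map_add' := fun X Y => by simp [add_mulVec]
      map_smul' := fun c X => by simp [smul_mulVec] }
  obtain ⟨X, hX, hXA⟩ := exists_mem_peripheralSubspace_apply_eq (hv.norm_map_le h1) A (x, 0)
    (C := 1) fun q => by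
      obtain ⟨P, hP, hPx, hPy⟩ := exists_norm_le_one_mulVec_eq
        (h.dotProduct_eq_zero_of_mem_krausOrbit hS hpos q)
      refine ⟨P, hP, Prod.ext ?_ ?_⟩
      · change (Φ ^ q) P *ᵥ x = x
        simpa using hv.pow_mulVec_eq_smul h1 (c := 1) q x (by simpa using hPx)
      · change (Φ ^ q) P *ᵥ y = 0
        simpa using hv.pow_mulVec_eq_smul h1 (c := 0) q y (by simpa using hPy)
  exact ⟨X, hX, congrArg Prod.fst hXA, congrArg Prod.snd hXA⟩

end Orbit

/-! ### Contradiction from two orthonormal vectors in the range. -/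

theorem exists_orthonormal_of_one_lt_rank {d : ℕ} {P : Matrix (Fin d) (Fin d) ℂ}
    (hP : IsIdempotentElem P) (hr : 1 < P.rank) :
    ∃ x y : Fin d → ℂ, P *ᵥ x = x ∧ P *ᵥ y = y ∧ star x ⬝ᵥ x = 1 ∧ star y ⬝ᵥ y = 1 ∧
      star x ⬝ᵥ y = 0 := by
  let R := LinearMap.range (Matrix.toEuclideanLin P)
  have hR : Module.finrank ℂ R = P.rank := by
    rw [Matrix.rank_eq_finrank_range_toLin P (PiLp.basisFun 2 ℂ (Fin d)) (PiLp.basisFun 2 ℂ (Fin d)),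
      ← Matrix.toLpLin_eq_toLin]
  let b := stdOrthonormalBasis ℂ R
  let i : Fin (Module.finrank ℂ R) := ⟨0, by omega⟩
  let j : Fin (Module.finrank ℂ R) := ⟨1, by omega⟩
  have hfix : ∀ z : R, P *ᵥ (z : EuclideanSpace ℂ (Fin d)).ofLp =
      (z : EuclideanSpace ℂ (Fin d)).ofLp := by
    rintro ⟨_, w, rfl⟩
    change P *ᵥ (P *ᵥ w.ofLp) = P *ᵥ w.ofLp
    rw [mulVec_mulVec, hP.eq]
  have hdot : ∀ z w : R, star (z : EuclideanSpace ℂ (Fin d)).ofLp ⬝ᵥ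
      (w : EuclideanSpace ℂ (Fin d)).ofLp = inner ℂ z w := by
    intro z w
    rw [Submodule.coe_inner, EuclideanSpace.inner_eq_star_dotProduct, dotProduct_comm]
  have horth := orthonormal_iff_ite.mp b.orthonormal
  refine ⟨_, _, hfix (b i), hfix (b j), ?_, ?_, ?_⟩
  · rw [hdot, horth, if_pos rfl]
  · rw [hdot, horth, if_pos rfl]
  · rw [hdot, horth, if_neg (by simp [i, j])]

/-- A non-singular randomization of an irreducible quantum channel purifies. -/
theorem purifies_outcomeMeasure {d k : ℕ} [NeZero k]
    {Φ : Matrix (Fin d) (Fin d) ℂ →ₗ[ℂ] Matrix (Fin d) (Fin d) ℂ} (h1 : Φ 1 = 1)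
    {v : Fin k → Matrix (Fin d) (Fin d) ℂ} (hv : IsKrausDecomposition Φ v)
    {r : Fin k → U k} (hr : IsRowSelector r) (lam : Measure (U k)) [IsProbabilityMeasure lam]
    (hirr : IsIrreducible Φ) (hns : NonSingular (outcomeMeasure r lam)) :
    Purifies (outcomeMeasure r lam) (krausAt v) := by
  refine ⟨fun i j => ?_, fun i j => ?_, fun i j => ?_, fun P hP hae => ?_⟩
  · exact ((continuous_apply j).comp ((continuous_apply i).comp
      (continuous_krausAt v))).measurable
  · exact integrable_of_continuous_U (continuous_krausAt_conjTranspose_mul_self_apply v i j) _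
  · exact integral_outcomeMeasure v hr (hv.sum_eq_one h1) lam i j
  by_contra! hrank
  obtain ⟨x, y, hPx, hPy, hx, hy, hxy⟩ :=
    exists_orthonormal_of_one_lt_rank hP.isIdempotentElem hrank
  have hyx : star y ⬝ᵥ x = 0 := by
    have := congrArg star hxy
    rwa [← star_dotProduct, star_zero] at this
  have horth : ∀ {a b : Fin d → ℂ}, P *ᵥ a = a → P *ᵥ b = b → star a ⬝ᵥ b = 0 →
      ∃ X ∈ peripheralSubspace Φ, X *ᵥ a = a ∧ X *ᵥ b = 0 := fun ha hb hab =>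
    (trajectoryOrthogonal_of_ae (outcomeMeasure r lam) hP.isSelfAdjoint
      (fun p hp => (hae p hp).mono fun ω hω => ⟨_, hω⟩) ha hb hab).exists_mem_peripheralSubspace
      Measure.isClosed_support hns hv h1
  obtain ⟨X, hX, hXx, hXy⟩ := horth hPx hPy hxy
  -- The vectors `x + y` and `x - y` are orthogonal because `x` and `y` have equal norms. The
  -- resulting `Y` sends `y` to `(x + y)/2`, mixing the directions that `X` separates.
  obtain ⟨Y, hY, hYadd, hYsub⟩ := horth (a := x + y) (b := x - y)
    (by rw [mulVec_add, hPx, hPy]) (by rw [mulVec_sub, hPx, hPy])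
    (by simp [add_dotProduct, dotProduct_sub, hx, hy, hxy, hyx])
  have hcomm := hv.commute_of_mem_peripheralSubspace h1 hirr hX hY
  have hYy : (2 : ℂ) • Y *ᵥ y = x + y := by
    have h2 : (2 : ℂ) • y = (x + y) - (x - y) := by module
    rw [← mulVec_smul, h2, mulVec_sub, hYadd, hYsub, sub_zero]
  have h3 : X *ᵥ (Y *ᵥ y) = 0 := by
    rw [mulVec_mulVec, hcomm.eq, ← mulVec_mulVec, hXy, mulVec_zero]
  have hx0 : x = 0 := by
    have := congrArg (X *ᵥ ·) hYy
    simpa [mulVec_smul, h3, mulVec_add, hXx, hXy] using this.symm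
  simp [hx0] at hx

end RandomizedTrajectory

theorem theorem3p2 {d k : ℕ} [NeZero k]
    (Φ : Matrix (Fin d) (Fin d) ℂ →ₗ[ℂ] Matrix (Fin d) (Fin d) ℂ)
    (hΦ : RandomizedTrajectory.IsQuantumChannel Φ)
    (v : Fin k → Matrix (Fin d) (Fin d) ℂ)
    (hv : RandomizedTrajectory.IsKrausDecomposition Φ v)
    (r : Fin k → RandomizedTrajectory.U k)
    (hr : RandomizedTrajectory.IsRowSelector r)
    (lam : MeasureTheory.Measure (RandomizedTrajectory.U k))
    [MeasureTheory.IsProbabilityMeasure lam]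
    (hirr : RandomizedTrajectory.IsIrreducible Φ)
    (hns : RandomizedTrajectory.NonSingular (RandomizedTrajectory.outcomeMeasure r lam)) :
    RandomizedTrajectory.Purifies (RandomizedTrajectory.outcomeMeasure r lam)
      (RandomizedTrajectory.krausAt v) :=
  RandomizedTrajectory.purifies_outcomeMeasure hΦ.map_one hv hr lam hirr hns
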